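/- Throughout, $\mathbb N=\{0,1,2,\dots\}$ and $k\ge 1$ is an integer. A polychromatic $k$-coloring of a hypergraph is a coloring of its vertices with $k$ colors such that every edge contains a vertex of each color. For a family $\mathcal H$ of hypergraphs, $m_{\mathcal H}(k)$ is the smallest positive integer $m$ such that for every $H\in\mathcal H$ the hypergraph obtained from $H$ by deleting all edges with fewer than $m$ vertices has a polychromatic $k$-coloring; $m_{\mathcal H}(k)=\infty$ if there is no such $m$. Let $\mathcal T_3$ be the family of hypergraphs $(V,E)$ with $V\subset\mathbb R^3$ finite in which every edge has the form $V\cap\{(x,y,z): x_0\le x,\ y\le y_0,\ z\le z_0\}$ for some $x_0,y_0,z_0\in\mathbb R$. For $D,M\subseteq\mathbb N$ let $m^\infty_{D,M}(k)=m_{\mathcal A}(k)$, where $\mathcal A$ is the family of hypergraphs $(S,E)$ with $S\subset\mathbb N$ finite in which every edge has the form $S\cap\{a+jd: j\in\mathbb N\}$ with $d\in D$, $a\in\mathbb N$ and $a-rd\in M$ for some $r\in\mathbb N$. (1) For every integer $t\ge 2$, $m^\infty_{\{t^i:\,i\in\mathbb N\},\,\mathbb N}(k)\le m_{\mathcal T_3}(k)$.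 (2) Let $p,q$ be positive coprime integers and let $M\subseteq\mathbb N$ contain at most one element of every residue class modulo $pq$. Then $$m^\infty_{\{p^iq^j:\,i,j\in\mathbb N\},\,M}(k)\le |M|\,(m_{\mathcal T_3}(k)-1)+1$$ (where $0\cdot\infty=0$). Moreover, if $M=\{0\}$ and $p,q\ge 2$, then equality holds. (3) Let $p_1,p_2,p_3\ge 2$ be pairwise coprime integers and $k\ge 2$. Then $m^\infty_{\{p_1^{j_1}p_2^{j_2}p_3^{j_3}:\,j_1,j_2,j_3\in\mathbb N\},\,\{0\}}(k)=\infty$. -/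

import Mathlib

namespace Polychromatic

/-- `H` restricted to its edges of size at least `m`; the vertex set is unchanged. -/
def edgesGE {α : Type*} (H : Hypergraph α) (m : ℕ) : Hypergraph α where
  vertexSet := H.vertexSet
  edgeSet := {e | e ∈ H.edgeSet ∧ (m : ℕ∞) ≤ e.encard}
  subset_vertexSet_of_mem_edgeSet' := fun _ he => H.subset_vertexSet_of_mem_edgeSet' he.1

/-- `c` is a polychromatic `k`-coloring of the vertices of `H`:
every edge contains a vertex of each of the `k` colors. -/
def IsPolychromatic {α : Type*} (H : Hypergraph α) {k : ℕ} (c : H.vertexSet → Fin k) : Prop :=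
  ∀ e ∈ H.edgeSet, ∀ i : Fin k, ∃ v : H.vertexSet, (v : α) ∈ e ∧ c v = i

/-- The smallest positive integer `m` such that for every `H` in the family `F` the hypergraph
`edgesGE H m` has a polychromatic `k`-coloring; `⊤` if there is no such `m`. -/
noncomputable def mParam {α : Type*} (F : Set (Hypergraph α)) (k : ℕ) : ℕ∞ :=
  sInf {x : ℕ∞ | ∃ m : ℕ, 1 ≤ m ∧ x = (m : ℕ∞) ∧
    ∀ H ∈ F, ∃ c : (edgesGE H m).vertexSet → Fin k, IsPolychromatic (edgesGE H m) c}

/-- The octant in `ℝ³` with corner `(x₀, y₀, z₀)`. -/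
def octant (x₀ y₀ z₀ : ℝ) : Set (ℝ × ℝ × ℝ) :=
  {P | x₀ ≤ P.1 ∧ P.2.1 ≤ y₀ ∧ P.2.2 ≤ z₀}

/-- The family of hypergraphs on finite subsets of `ℝ³` whose edges are captured by octants. -/
def octantFamily : Set (Hypergraph (ℝ × ℝ × ℝ)) :=
  {H | H.vertexSet.Finite ∧
    ∀ e ∈ H.edgeSet, ∃ x₀ y₀ z₀ : ℝ, e = H.vertexSet ∩ octant x₀ y₀ z₀}

/-- The infinite arithmetic progression with initial term `a` and difference `d`. -/
def infiniteAP (a d : ℕ) : Set ℕ := {n | ∃ j : ℕ, n = a + j * d}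

/-- The family of hypergraphs on finite subsets of `ℕ` all of whose edges are traces of infinite
arithmetic progressions with difference `d ∈ D` and initial term `a` such that `a - r * d ∈ M`
for some natural number `r` (a subtraction of integers, written here additively). -/
def infiniteAPFamily (D M : Set ℕ) : Set (Hypergraph ℕ) :=
  {H | H.vertexSet.Finite ∧
    ∀ e ∈ H.edgeSet, ∃ a : ℕ, ∃ d ∈ D, (∃ r : ℕ, ∃ μ ∈ M, a = μ + r * d) ∧
      e = infiniteAP a d ∩ H.vertexSet}

/-- `m` for octants. -/
noncomputable def mOctant (k : ℕ) : ℕ∞ := mParam octantFamily k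

/-- `m` for infinite arithmetic progressions with difference set `D` and set of bases `M`. -/
noncomputable def mInfiniteAP (D M : Set ℕ) (k : ℕ) : ℕ∞ := mParam (infiniteAPFamily D M) k

end Polychromatic

/-!
All the bounds come from translating between octants and arithmetic progressions. By ranking
coordinates, octants in `ℝ³` may be replaced by octants in a product of any three linear orders
(`ColorableAt.exists_coloring`). So to bound a parameter of arithmetic progressions by `mOctant`
one has to place the vertices `u` at points `(u, y u, z u)` for suitable `y` and `z`: the first
coordinate takes care of the initial term of a progression, the other two of its residue class.

For differences `t ^ i` the residues of `u` modulo `1, t, t ^ 2, …`, ordered lexicographically, make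
every residue class modulo a power of `t` an interval (`modEq_of_residueKey_le`), and two
coordinates cut out an interval.

For differences `p ^ i * q ^ j` and bases in `M`, let `a u` and `b u` be the elements of `M` nearest
to `u` in the `p`-adic and in the `q`-adic sense, ties being broken by the order of residues. The
bases `a ≡ μ` modulo `p ^ i` form an interval `I` with first element `lo`, and `u ≡ μ` modulo `p ^ i`
holds if and only if `a u ∈ I` and, in case `a u = lo`, the base `lo` is `p`-adically at least
`i`-close to `u` (`IsNearest.modEq_iff`). The same holds for `q` and `b`, with an interval `J`. The
coordinates `y` and `z` order the vertices lexicographically by `a`, then by `b` in reverse, then by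
closeness. Each progression is then a union of at most `|I| - 1 + |J|` octant traces, or of `|M|` of
them if `i = 0` or `j = 0`. For `i, j ≥ 1` the intervals share only `μ`, since `M` is separated
modulo `p * q`; so `|M|` traces always suffice (`exists_octants_cover`), and by the pigeonhole
principle one of them has at least `mOctant k` vertices if the progression has more than
`|M| * (mOctant k - 1)`.

Conversely, lower bounds on `n + 1` coordinates of a vertex can be encoded by one natural number:
divisibility by powers of `n` coprime numbers encodes `n` of the coordinates, and the size, on a
much larger scale, the remaining one (`ColorableAt.exists_coloring_of_infiniteAP`). For `n = 2` these
are the octants, which yields equality for `M = {0}`. For `n = 3` four coordinates suffice to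
realize both the sets of siblings and the paths from the root to the leaves in the complete `m`-ary
tree of depth `m` (`not_colorableAt`). If every set of siblings contains the first color, then some
path consists of the first color only, so no `m` works.
-/

namespace Polychromatic

/-! ### The parameter of a family -/


/-- Every hypergraph of the family `F`, restricted to its edges of size at least `m`, has a
polychromatic `k`-coloring. The parameter `mParam F k` is the least positive such `m`. -/
def ColorableAt {α : Type*} (F : Set (Hypergraph α)) (m k : ℕ) : Prop :=
  ∀ H ∈ F, ∃ c : (edgesGE H m).vertexSet → Fin k, IsPolychromatic (edgesGE H m) c

theorem mParam_le {α : Type*} {F : Set (Hypergraph α)} {m k : ℕ} (hm : 1 ≤ m)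
    (h : ColorableAt F m k) : mParam F k ≤ m :=
  sInf_le ⟨m, hm, rfl, h⟩

theorem mParam_eq_top_or {α : Type*} (F : Set (Hypergraph α)) (k : ℕ) :
    mParam F k = ⊤ ∨ ∃ m : ℕ, 1 ≤ m ∧ mParam F k = m ∧ ColorableAt F m k := by
  rcases Set.eq_empty_or_nonempty {x : ℕ∞ | ∃ m : ℕ, 1 ≤ m ∧ x = (m : ℕ∞) ∧
    ∀ H ∈ F, ∃ c : (edgesGE H m).vertexSet → Fin k, IsPolychromatic (edgesGE H m) c} with h | h
  · left
    rw [mParam, h, sInf_empty]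
  · right
    obtain ⟨m, hm, he, hc⟩ := csInf_mem h
    exact ⟨m, hm, he, hc⟩

theorem mParam_le_mParam {α β : Type*} {F : Set (Hypergraph α)} {G : Set (Hypergraph β)} {k : ℕ}
    (h : ∀ m, 1 ≤ m → ColorableAt G m k → ColorableAt F m k) : mParam F k ≤ mParam G k := by
  rcases mParam_eq_top_or G k with hG | ⟨m, hm, hG, hc⟩
  · rw [hG]; exact le_top
  · rw [hG]; exact mParam_le hm (h m hm hc)

/-- It suffices to color the whole ambient type, and to check the edges given as finite sets. -/
theorem colorableAt_of_finset {α : Type*} {F : Set (Hypergraph α)} {m k : ℕ}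
    (hfin : ∀ H ∈ F, H.vertexSet.Finite)
    (h : ∀ H ∈ F, ∃ c : α → Fin k, ∀ T : Finset α, (T : Set α) ∈ H.edgeSet → m ≤ T.card →
      ∀ i, ∃ v ∈ T, c v = i) : ColorableAt F m k := by
  intro H hH
  obtain ⟨c, hc⟩ := h H hH
  refine ⟨fun v => c v, fun e he i => ?_⟩
  have hsub : e ⊆ H.vertexSet := H.subset_vertexSet_of_mem_edgeSet' he.1
  have hef := (hfin H hH).subset hsub
  obtain ⟨v, hv, hvi⟩ := hc hef.toFinset (by simpa using he.1) (by
    have := he.2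
    rw [hef.encard_eq_coe_toFinset_card] at this
    exact_mod_cast this) i
  rw [Set.Finite.mem_toFinset] at hv
  exact ⟨⟨v, hsub hv⟩, hv, hvi⟩

/-! ### Octant traces in products of linear orders -/

section Rank

variable {α Y : Type*} [LinearOrder Y]

/-- The number of elements of `S` whose `f`-value is at most `y`: it turns the values of `f` on
`S` into natural numbers and keeps all the comparisons of these values with a threshold. -/
def rank (S : Finset α) (f : α → Y) (y : Y) : ℕ := (S.filter fun s => f s ≤ y).card

theorem rank_le_rank_iff {S : Finset α} {f : α → Y} {v : α} (hv : v ∈ S) (y : Y) :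
    rank S f (f v) ≤ rank S f y ↔ f v ≤ y := by
  constructor
  · intro h
    by_contra! hlt
    refine absurd h (not_le.2 (Finset.card_lt_card ?_))
    rw [Finset.ssubset_iff_of_subset
      (Finset.monotone_filter_right S fun s _ hs => le_trans hs hlt.le)]
    exact ⟨v, by simp [hv], by simp [hlt]⟩
  · intro h
    exact Finset.card_le_card (Finset.monotone_filter_right S fun s _ hs => le_trans hs h)

end Rank

/-- If the octant family is colorable at `m`, so are the traces of octants in any product of three
linear orders, provided that the first coordinate separates the vertices. -/
theorem ColorableAt.exists_coloring {m k : ℕ} (h : ColorableAt octantFamily m k) (hk : 1 ≤ k)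
    {α X Y Z : Type*} [LinearOrder X] [LinearOrder Y] [LinearOrder Z] (S : Finset α)
    (x : α → X) (y : α → Y) (z : α → Z) (hx : Set.InjOn x S) :
    ∃ c : α → Fin k, ∀ X₀ Y₀ Z₀,
      m ≤ (S.filter fun v => X₀ ≤ x v ∧ y v ≤ Y₀ ∧ z v ≤ Z₀).card →
      ∀ i, ∃ v ∈ S, (X₀ ≤ x v ∧ y v ≤ Y₀ ∧ z v ≤ Z₀) ∧ c v = i := by
  classical
  let x' : α → Xᵒᵈ := fun v => OrderDual.toDual (x v)
  let P : α → ℝ × ℝ × ℝ := fun v =>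
    (-(rank S x' (x' v) : ℝ), (rank S y (y v) : ℝ), (rank S z (z v) : ℝ))
  have hP : Set.InjOn P S := by
    intro v hv w hw hvw
    have h1 : rank S x' (x' v) = rank S x' (x' w) := by
      have := congrArg Prod.fst hvw
      simpa [P] using this
    have h2 := (rank_le_rank_iff (f := x') (S := S) hv _).1 h1.le
    have h3 := (rank_le_rank_iff (f := x') (S := S) hw _).1 h1.ge
    exact hx hv hw (le_antisymm h3 h2)
  let H : Hypergraph (ℝ × ℝ × ℝ) :=
    { vertexSet := P '' S
      edgeSet := {e | ∃ x₀ y₀ z₀ : ℝ, e = P '' S ∩ octant x₀ y₀ z₀}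
      subset_vertexSet_of_mem_edgeSet' := by
        rintro e ⟨x₀, y₀, z₀, rfl⟩
        exact Set.inter_subset_left }
  obtain ⟨c, hc⟩ := h H ⟨S.finite_toSet.image P, fun e he => he⟩
  refine ⟨fun v => if hv : v ∈ S then c ⟨P v, v, hv, rfl⟩ else ⟨0, hk⟩, ?_⟩
  intro X₀ Y₀ Z₀ hm i
  have key : P '' S ∩ octant (-(rank S x' (OrderDual.toDual X₀) : ℝ)) (rank S y Y₀) (rank S z Z₀)
      = P '' (S.filter fun v => X₀ ≤ x v ∧ y v ≤ Y₀ ∧ z v ≤ Z₀ : Finset α) := by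
    have mem : ∀ v ∈ S, P v ∈ octant (-(rank S x' (OrderDual.toDual X₀) : ℝ)) (rank S y Y₀)
        (rank S z Z₀) ↔ X₀ ≤ x v ∧ y v ≤ Y₀ ∧ z v ≤ Z₀ := by
      intro v hv
      simp only [octant, Set.mem_ofPred_eq, P, neg_le_neg_iff, Nat.cast_le]
      rw [rank_le_rank_iff hv, rank_le_rank_iff hv, rank_le_rank_iff hv]
      exact Iff.rfl
    ext r
    constructor
    · rintro ⟨⟨v, hv, rfl⟩, hr⟩
      exact ⟨v, by simpa using ⟨hv, (mem v hv).1 hr⟩, rfl⟩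
    · rintro ⟨v, hv, rfl⟩
      have hv' := Finset.mem_filter.1 (Finset.mem_coe.1 hv)
      exact ⟨⟨v, hv'.1, rfl⟩, (mem v hv'.1).2 hv'.2⟩
  obtain ⟨⟨r, hrH⟩, hr, hri⟩ := hc _ ⟨⟨_, _, _, rfl⟩, by
    rw [key, Set.InjOn.encard_image (hP.mono (by
      intro v hv
      exact (Finset.mem_filter.1 (Finset.mem_coe.1 hv)).1)), Set.encard_coe_eq_coe_finsetCard]
    exact_mod_cast hm⟩ i
  change r ∈ P '' S ∩ octant _ _ _ at hr
  rw [key] at hr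
  obtain ⟨v, hv, rfl⟩ := hr
  have hv' := Finset.mem_filter.1 (Finset.mem_coe.1 hv)
  exact ⟨v, hv'.1, hv'.2, by simpa [hv'.1] using hri⟩

/-! ### The order of residues -/

/-- The sequence of residues of `n` modulo `1, p, p ^ 2, …`, with `n` itself as a tie-breaker, in
lexicographic order. Every residue class modulo a power of `p` is an interval of this order
(`modEq_of_residueKey_le`). The tie-breaker only matters for `p = 1`. -/
def residueKey (p n : ℕ) : Lex (ℕ → ℕ) ×ₗ ℕ := toLex (toLex fun i => n % p ^ i, n)

theorem residueKey_injective (p : ℕ) : Function.Injective (residueKey p) := by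
  intro a b h
  exact congrArg (fun r => (ofLex r).2) h

theorem residueKey_le {p a b : ℕ} (h : residueKey p a ≤ residueKey p b) :
    (∀ i, a ≡ b [MOD p ^ i]) ∨ ∃ j, (∀ i < j, a ≡ b [MOD p ^ i]) ∧ a % p ^ j < b % p ^ j := by
  rw [residueKey, residueKey, Prod.Lex.toLex_le_toLex] at h
  rcases h with h | ⟨h, -⟩
  · obtain ⟨j, hj, hlt⟩ := h
    exact Or.inr ⟨j, hj, hlt⟩
  · exact Or.inl fun i => congrFun (congrArg ofLex h) i

theorem modEq_of_residueKey_le {p a b c i : ℕ} (hab : residueKey p a ≤ residueKey p b)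
    (hbc : residueKey p b ≤ residueKey p c) (hac : a ≡ c [MOD p ^ i]) : b ≡ a [MOD p ^ i] := by
  have hle : ∀ j ≤ i, a % p ^ j = c % p ^ j := fun j hj => hac.of_dvd (pow_dvd_pow p hj)
  rcases residueKey_le hab with h | ⟨j, hj, hjlt⟩
  · exact (h i).symm
  by_cases hij : i < j
  · exact (hj i hij).symm
  push Not at hij
  exfalso
  rcases residueKey_le hbc with h | ⟨l, hl, hllt⟩
  · have := h j
    have := hle j hij
    simp only [Nat.ModEq] at *
    omega
  · rcases lt_trichotomy l j with hlj | rfl | hlj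
    · have h1 := hj l hlj
      have h2 := hle l (hlj.le.trans hij)
      simp only [Nat.ModEq] at *
      omega
    · have h2 := hle l hij
      omega
    · have h1 := hl j hlj
      have h2 := hle j hij
      simp only [Nat.ModEq] at *
      omega

theorem mem_infiniteAP_iff {a d n : ℕ} : n ∈ infiniteAP a d ↔ a ≤ n ∧ n ≡ a [MOD d] := by
  constructor
  · rintro ⟨j, rfl⟩
    exact ⟨Nat.le_add_right _ _, by simp [Nat.ModEq]⟩
  · rintro ⟨h, hm⟩
    obtain ⟨j, hj⟩ := (Nat.modEq_iff_dvd' h).1 hm.symm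
    exact ⟨j, by rw [mul_comm, ← hj]; omega⟩

/-- With the residues as second and the reversed residues as third coordinate, an arithmetic
progression whose difference is a power of `t` is a trace of an octant. -/
theorem mInfiniteAP_pow_le (k : ℕ) (hk : 1 ≤ k) (t : ℕ) :
    mInfiniteAP {d | ∃ i : ℕ, d = t ^ i} Set.univ k ≤ mOctant k := by
  refine mParam_le_mParam fun m hm hc => colorableAt_of_finset (fun H hH => hH.1) fun H hH => ?_
  obtain ⟨hfin, hedge⟩ := hH
  obtain ⟨c, hc⟩ := hc.exists_coloring hk hfin.toFinset (fun n => n) (residueKey t)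
    (fun n => OrderDual.toDual (residueKey t n)) (fun _ _ _ _ h => h)
  refine ⟨c, fun T hT hmT i => ?_⟩
  obtain ⟨a, d, ⟨j, rfl⟩, -, hTe⟩ := hedge T hT
  have hmem : ∀ n, n ∈ T ↔ (a ≤ n ∧ n ≡ a [MOD t ^ j]) ∧ n ∈ H.vertexSet := by
    intro n
    rw [← Finset.mem_coe, hTe, Set.mem_inter_iff, mem_infiniteAP_iff]
  have hne : T.Nonempty := Finset.card_pos.1 (by omega)
  obtain ⟨u, hu, humax⟩ := T.exists_max_image (residueKey t) hne
  obtain ⟨l, hl, hlmin⟩ := T.exists_min_image (residueKey t) hne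
  have hTf : T = hfin.toFinset.filter fun n => a ≤ n ∧ residueKey t n ≤ residueKey t u ∧
      OrderDual.toDual (residueKey t n) ≤ OrderDual.toDual (residueKey t l) := by
    ext n
    simp only [Finset.mem_filter, Set.Finite.mem_toFinset]
    constructor
    · intro hn
      exact ⟨((hmem n).1 hn).2, ((hmem n).1 hn).1.1, humax n hn, hlmin n hn⟩
    · rintro ⟨hnH, han, hnu, hln⟩
      refine (hmem n).2 ⟨⟨han, ?_⟩, hnH⟩
      have hla := ((hmem l).1 hl).1.2
      exact (modEq_of_residueKey_le hln hnu (hla.trans ((hmem u).1 hu).1.2.symm)).trans hla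
  obtain ⟨v, hvH, hv, hvi⟩ := hc a _ _ (hTf ▸ hmT) i
  exact ⟨v, by rw [hTf]; simpa using ⟨by simpa using hvH, hv⟩, hvi⟩

/-! ### Nearest bases -/

/-- The largest `i` such that `u` and `a` are congruent modulo `p ^ i`; it is `⊤` if `u = a`, and
always `⊤` if `p = 1`. -/
noncomputable def closeness (p u a : ℕ) : ℕ∞ := emultiplicity (p : ℤ) ((u : ℤ) - a)

theorem le_closeness_iff {p u a i : ℕ} : (i : ℕ∞) ≤ closeness p u a ↔ u ≡ a [MOD p ^ i] := by
  rw [closeness, ← pow_dvd_iff_le_emultiplicity, Nat.ModEq.comm, Nat.modEq_iff_dvd]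
  norm_cast

/-- `a` is the element of `M` closest to `u` for the `p`-adic closeness, ties being broken in
favor of the smallest `residueKey`. -/
def IsNearest (p : ℕ) (M : Finset ℕ) (u a : ℕ) : Prop :=
  a ∈ M ∧ ∀ b ∈ M, closeness p u b < closeness p u a ∨
    closeness p u b = closeness p u a ∧ residueKey p a ≤ residueKey p b

theorem exists_isNearest (p : ℕ) {M : Finset ℕ} (hM : M.Nonempty) (u : ℕ) :
    ∃ a, IsNearest p M u a := by
  obtain ⟨a, ha, h⟩ := M.exists_max_image
    (fun b => toLex (closeness p u b, OrderDual.toDual (residueKey p b))) hM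
  exact ⟨a, ha, fun b hb => Prod.Lex.toLex_le_toLex.1 (h b hb)⟩

/-- Only for the first base `lo` of a residue class does membership of `u` in the class depend on
more than the nearest base of `u`: if the nearest base were another base `a` of the class while
`u` is outside of the class, then `lo` would be as close to `u` as `a` and would win the tie. -/
theorem IsNearest.modEq_iff {p : ℕ} {M : Finset ℕ} {u a μ lo i : ℕ} (h : IsNearest p M u a)
    (hμ : μ ∈ M) (hlo : lo ∈ M) (hloμ : lo ≡ μ [MOD p ^ i])
    (hmin : ∀ b ∈ M, b ≡ μ [MOD p ^ i] → residueKey p lo ≤ residueKey p b) :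
    u ≡ μ [MOD p ^ i] ↔ a ≡ μ [MOD p ^ i] ∧ (a = lo → (i : ℕ∞) ≤ closeness p u a) := by
  constructor
  · intro hu
    have hia : (i : ℕ∞) ≤ closeness p u a := by
      have h1 : (i : ℕ∞) ≤ closeness p u μ := le_closeness_iff.2 hu
      rcases h.2 μ hμ with h2 | h2
      · exact h1.trans h2.le
      · exact h1.trans h2.1.le
    exact ⟨(le_closeness_iff.1 hia).symm.trans hu, fun _ => hia⟩
  · rintro ⟨haμ, hal⟩
    suffices (i : ℕ∞) ≤ closeness p u a from (le_closeness_iff.1 this).trans haμ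
    by_contra! hlt
    have hne : a ≠ lo := fun e => absurd (hal e) (not_le.2 hlt)
    obtain ⟨s, hs⟩ := ENat.ne_top_iff_exists.1 (ne_top_of_lt hlt)
    rw [← hs, Nat.cast_lt] at hlt
    have hslo : (s : ℕ∞) ≤ closeness p u lo := le_closeness_iff.2
      ((le_closeness_iff.1 hs.le).trans ((haμ.trans hloμ.symm).of_dvd (pow_dvd_pow p hlt.le)))
    rcases h.2 lo hlo with h2 | h2
    · exact absurd (hs ▸ hslo) (not_le.2 h2)
    · exact hne (residueKey_injective p (le_antisymm h2.2 (hmin a h.1 haμ)))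

/-! ### Octants capturing pieces of an arithmetic progression -/

/-- The second octant coordinate of a vertex whose nearest bases for `p` and `q` are `a` and `b`
and whose `q`-closeness to `b` is `s`. -/
def coordY (p q a b : ℕ) (s : ℕ∞) :
    (Lex (ℕ → ℕ) ×ₗ ℕ) ×ₗ ((Lex (ℕ → ℕ) ×ₗ ℕ)ᵒᵈ ×ₗ ℕ∞ᵒᵈ) :=
  toLex (residueKey p a, toLex (OrderDual.toDual (residueKey q b), OrderDual.toDual s))

/-- The third octant coordinate of a vertex whose nearest bases for `p` and `q` are `a` and `b`
and whose `p`-closeness to `a` is `s`. -/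
def coordZ (p q a b : ℕ) (s : ℕ∞) :
    (Lex (ℕ → ℕ) ×ₗ ℕ)ᵒᵈ ×ₗ ((Lex (ℕ → ℕ) ×ₗ ℕ) ×ₗ ℕ∞ᵒᵈ) :=
  toLex (OrderDual.toDual (residueKey p a), toLex (residueKey q b, OrderDual.toDual s))

theorem coordY_le {p q a b α β : ℕ} {s σ : ℕ∞} :
    coordY p q a b s ≤ coordY p q α β σ ↔ residueKey p a < residueKey p α ∨
      a = α ∧ (residueKey q β < residueKey q b ∨ b = β ∧ σ ≤ s) := by
  simp only [coordY, Prod.Lex.toLex_le_toLex, OrderDual.toDual_lt_toDual,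
    OrderDual.toDual_le_toDual, EmbeddingLike.apply_eq_iff_eq, (residueKey_injective _).eq_iff]

theorem coordZ_le {p q a b α β : ℕ} {s σ : ℕ∞} :
    coordZ p q a b s ≤ coordZ p q α β σ ↔ residueKey p α < residueKey p a ∨
      a = α ∧ (residueKey q b < residueKey q β ∨ b = β ∧ σ ≤ s) := by
  simp only [coordZ, Prod.Lex.toLex_le_toLex, OrderDual.toDual_lt_toDual,
    OrderDual.toDual_le_toDual, EmbeddingLike.apply_eq_iff_eq, (residueKey_injective _).eq_iff]

/-- If both octant coordinates are bounded by thresholds with the same first base `α`, then they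
cut out the vertices with nearest base `α` whose other nearest base lies in an interval. -/
theorem coordY_le_and_coordZ_le {p q a b α β γ : ℕ} {s t σ τ : ℕ∞} :
    coordY p q a b s ≤ coordY p q α β σ ∧ coordZ p q a b t ≤ coordZ p q α γ τ ↔
      a = α ∧ (residueKey q β < residueKey q b ∨ b = β ∧ σ ≤ s) ∧
        (residueKey q b < residueKey q γ ∨ b = γ ∧ τ ≤ t) := by
  rw [coordY_le, coordZ_le]
  constructor
  · rintro ⟨h1 | h1, h2 | h2⟩
    · exact absurd h1 h2.asymm
    · exact absurd h1 (by rw [h2.1]; exact lt_irrefl _)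
    · exact absurd h2 (by rw [h1.1]; exact lt_irrefl _)
    · exact ⟨h1.1, h1.2, h2.2⟩
  · rintro ⟨h, h1, h2⟩
    exact ⟨Or.inr ⟨h, h1⟩, Or.inr ⟨h, h2⟩⟩

theorem exists_le_card_of_cover {α ι : Type*} [DecidableEq α] {T : Finset α} (P : Finset ι)
    (piece : ι → Finset α) {n m : ℕ} (hP : P.card ≤ n) (hT : n * (m - 1) + 1 ≤ T.card)
    (hcover : ∀ u ∈ T, ∃ r ∈ P, u ∈ piece r) : ∃ r ∈ P, m ≤ (piece r).card := by
  by_contra! h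
  have h1 : T ⊆ P.biUnion piece := fun u hu => Finset.mem_biUnion.2 (hcover u hu)
  have h2 := Finset.card_le_card h1
  have h3 := Finset.card_biUnion_le_card_mul P piece (m - 1) fun r hr => by
    have := h r hr; omega
  have h4 := Nat.mul_le_mul_right (m - 1) hP
  omega

/-- An arithmetic progression with base `μ ∈ M` and difference `p ^ i * q ^ j` is covered by at
most `|M|` octant traces contained in it. The bases congruent to `μ` modulo `p ^ i` and modulo
`q ^ j` form intervals; let `lo` and `lo'` be their first elements. A vertex whose nearest base
for `p` is some `α ≠ lo` belongs to the progression as soon as it is congruent to `μ` modulo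
`q ^ j`, so there is one trace for each such `α`; the vertices with nearest base `lo` for `p` are
split according to their nearest base for `q`. The number of traces is then at
most `|I| - 1 + |J|`, which can exceed `|M|` only if `i = 0` or `j = 0`. For `i = 0` the vertices
with nearest base `lo` need no splitting, and for `j = 0 < i` all the traces with `α ≠ lo` merge with
one of those for `lo`. -/
theorem exists_octants_cover {p q : ℕ} (hpq : Nat.Coprime p q) {M : Finset ℕ}
    (hM : ∀ a ∈ M, ∀ b ∈ M, a ≡ b [MOD p * q] → a = b) {a b : ℕ → ℕ}
    (ha : ∀ u, IsNearest p M u (a u)) (hb : ∀ u, IsNearest q M u (b u)) {μ : ℕ} (hμ : μ ∈ M)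
    (i j : ℕ) :
    ∃ (P : Finset (ℕ ⊕ ℕ)) (Y : ℕ ⊕ ℕ → (Lex (ℕ → ℕ) ×ₗ ℕ) ×ₗ ((Lex (ℕ → ℕ) ×ₗ ℕ)ᵒᵈ ×ₗ ℕ∞ᵒᵈ))
      (Z : ℕ ⊕ ℕ → (Lex (ℕ → ℕ) ×ₗ ℕ)ᵒᵈ ×ₗ ((Lex (ℕ → ℕ) ×ₗ ℕ) ×ₗ ℕ∞ᵒᵈ)),
      P.card ≤ M.card ∧ ∀ u, u ≡ μ [MOD p ^ i * q ^ j] ↔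
        ∃ r ∈ P, coordY p q (a u) (b u) (closeness q u (b u)) ≤ Y r ∧
          coordZ p q (a u) (b u) (closeness p u (a u)) ≤ Z r := by
  classical
  set I := M.filter (· ≡ μ [MOD p ^ i]) with hI
  set J := M.filter (· ≡ μ [MOD q ^ j]) with hJ
  have hμI : μ ∈ I := by simp [hI, hμ, Nat.ModEq.refl]
  have hμJ : μ ∈ J := by simp [hJ, hμ, Nat.ModEq.refl]
  obtain ⟨lo, hlo, hlomin⟩ := I.exists_min_image (residueKey p) ⟨μ, hμI⟩
  obtain ⟨hi, hhi, hhimax⟩ := I.exists_max_image (residueKey p) ⟨μ, hμI⟩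
  obtain ⟨lo', hlo', hlomin'⟩ := J.exists_min_image (residueKey q) ⟨μ, hμJ⟩
  obtain ⟨hi', hhi', hhimax'⟩ := J.exists_max_image (residueKey q) ⟨μ, hμJ⟩
  have memI : ∀ x, x ∈ I ↔ x ∈ M ∧ x ≡ μ [MOD p ^ i] := by simp [hI]
  have memJ : ∀ x, x ∈ J ↔ x ∈ M ∧ x ≡ μ [MOD q ^ j] := by simp [hJ]
  have convI : ∀ x ∈ M, residueKey p lo ≤ residueKey p x → residueKey p x ≤ residueKey p hi →
      x ∈ I := fun x hx h1 h2 => (memI x).2 ⟨hx, (modEq_of_residueKey_le h1 h2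
        (((memI lo).1 hlo).2.trans ((memI hi).1 hhi).2.symm)).trans ((memI lo).1 hlo).2⟩
  have convJ : ∀ x ∈ M, residueKey q lo' ≤ residueKey q x → residueKey q x ≤ residueKey q hi' →
      x ∈ J := fun x hx h1 h2 => (memJ x).2 ⟨hx, (modEq_of_residueKey_le h1 h2
        (((memJ lo').1 hlo').2.trans ((memJ hi').1 hhi').2.symm)).trans ((memJ lo').1 hlo').2⟩
  have injp : ∀ x y, residueKey p x ≤ residueKey p y → x ≠ y → residueKey p x < residueKey p y :=
    fun x y h hne => lt_of_le_of_ne h fun e => hne (residueKey_injective p e)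
  have injq : ∀ x y, residueKey q x ≤ residueKey q y → x ≠ y → residueKey q x < residueKey q y :=
    fun x y h hne => lt_of_le_of_ne h fun e => hne (residueKey_injective q e)
  have hep : ∀ u, u ≡ μ [MOD p ^ i] ↔
      a u ∈ I ∧ (a u = lo → (i : ℕ∞) ≤ closeness p u (a u)) := by
    intro u
    rw [(ha u).modEq_iff hμ ((memI lo).1 hlo).1 ((memI lo).1 hlo).2
      fun x hx hxμ => hlomin x ((memI x).2 ⟨hx, hxμ⟩), memI, and_iff_right (ha u).1]
  have heq : ∀ u, u ≡ μ [MOD q ^ j] ↔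
      b u ∈ J ∧ (b u = lo' → (j : ℕ∞) ≤ closeness q u (b u)) := by
    intro u
    rw [(hb u).modEq_iff hμ ((memJ lo').1 hlo').1 ((memJ lo').1 hlo').2
      fun x hx hxμ => hlomin' x ((memJ x).2 ⟨hx, hxμ⟩), memJ, and_iff_right (hb u).1]
  have he : ∀ u, u ≡ μ [MOD p ^ i * q ^ j] ↔ u ≡ μ [MOD p ^ i] ∧ u ≡ μ [MOD q ^ j] :=
    fun u => (Nat.modEq_and_modEq_iff_modEq_mul (hpq.pow i j)).symm
  -- The trace of all vertices with nearest base `α` that are congruent to `μ` modulo `q ^ j`.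
  have hcol : ∀ α u, coordY p q (a u) (b u) (closeness q u (b u)) ≤ coordY p q α lo' j ∧
      coordZ p q (a u) (b u) (closeness p u (a u)) ≤ coordZ p q α hi' 0 ↔
        a u = α ∧ u ≡ μ [MOD q ^ j] := by
    intro α u
    rw [coordY_le_and_coordZ_le, heq]
    refine and_congr_right fun _ => ⟨?_, ?_⟩
    · rintro ⟨h1, h2⟩
      refine ⟨convJ _ (hb u).1 ?_ ?_, ?_⟩
      · rcases h1 with h1 | h1
        · exact h1.le
        · rw [h1.1]
      · rcases h2 with h2 | h2
        · exact h2.le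
        · rw [h2.1]
      · intro e
        rcases h1 with h1 | h1
        · exact absurd h1 (by rw [e]; exact lt_irrefl _)
        · exact h1.2
    · rintro ⟨h1, h2⟩
      constructor
      · by_cases e : b u = lo'
        · exact Or.inr ⟨e, h2 e⟩
        · exact Or.inl (injq _ _ (hlomin' _ h1) (Ne.symm e))
      · by_cases e : b u = hi'
        · exact Or.inr ⟨e, zero_le⟩
        · exact Or.inl (injq _ _ (hhimax' _ h1) e)
  -- The trace of all vertices of the progression with nearest bases `lo` and `β`.
  have hblock : ∀ β ∈ J, ∀ u, coordY p q (a u) (b u) (closeness q u (b u)) ≤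
        coordY p q lo β ((if β = lo' then j else 0 : ℕ) : ℕ∞) ∧
      coordZ p q (a u) (b u) (closeness p u (a u)) ≤ coordZ p q lo β i ↔
        a u = lo ∧ b u = β ∧ u ≡ μ [MOD p ^ i] ∧ u ≡ μ [MOD q ^ j] := by
    intro β hβ u
    rw [coordY_le_and_coordZ_le, hep, heq]
    refine and_congr_right fun hal => ⟨?_, ?_⟩
    · rintro ⟨h1 | h1, h2 | h2⟩
      · exact absurd h1 h2.asymm
      · exact absurd h1 (by rw [h2.1]; exact lt_irrefl _)
      · exact absurd h2 (by rw [h1.1]; exact lt_irrefl _)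
      · refine ⟨h1.1, ⟨hal ▸ hlo, fun _ => h2.2⟩, h1.1 ▸ hβ, fun e => ?_⟩
        have := h1.2
        rwa [if_pos (h1.1.symm.trans e)] at this
    · rintro ⟨h1, ⟨-, h2⟩, -, h3⟩
      refine ⟨Or.inr ⟨h1, ?_⟩, Or.inr ⟨h1, h2 hal⟩⟩
      split_ifs with e
      · exact h3 (h1.trans e)
      · exact zero_le
  rcases Nat.eq_zero_or_pos i with rfl | hipos
  · -- All of `M` is one class modulo `p ^ 0`, and every base contributes one trace.
    refine ⟨M.map Function.Embedding.inl, Sum.elim (fun α => coordY p q α lo' j) fun _ =>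
      coordY p q 0 0 0, Sum.elim (fun α => coordZ p q α hi' 0) fun _ => coordZ p q 0 0 0,
      by simp, fun u => ?_⟩
    simp only [Finset.mem_map, Function.Embedding.inl_apply, exists_exists_and_eq_and,
      Sum.elim_inl, hcol, he]
    constructor
    · rintro ⟨-, h⟩
      exact ⟨a u, (ha u).1, rfl, h⟩
    · rintro ⟨α, -, -, h⟩
      exact ⟨by simp [Nat.modEq_one], h⟩
  rcases Nat.eq_zero_or_pos j with rfl | hjpos
  · -- Here one trace consists of the vertices with nearest bases `(lo, lo')` and of all the
    -- vertices with nearest base `α ≠ lo` in the class.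
    have hJM : ∀ x ∈ M, x ∈ J := fun x hx => (memJ x).2 ⟨hx, by simp [Nat.modEq_one]⟩
    simp only [ite_self, Nat.cast_zero] at hblock
    have hrun : ∀ u, coordY p q (a u) (b u) (closeness q u (b u)) ≤ coordY p q hi lo' 0 ∧
        coordZ p q (a u) (b u) (closeness p u (a u)) ≤ coordZ p q lo lo' i ↔
          u ≡ μ [MOD p ^ i] ∧ (a u = lo → b u = lo') := by
      intro u
      have hbu := hlomin' _ (hJM _ (hb u).1)
      rw [coordY_le, coordZ_le, hep]
      constructor
      · rintro ⟨h1, h2⟩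
        have h3 : residueKey p (a u) ≤ residueKey p hi := by
          rcases h1 with h1 | h1
          · exact h1.le
          · rw [h1.1]
        rcases h2 with h2 | ⟨h2, h4 | h4⟩
        · exact ⟨⟨convI _ (ha u).1 h2.le h3, fun e => absurd h2 (by rw [e]; exact lt_irrefl _)⟩,
            fun e => absurd h2 (by rw [e]; exact lt_irrefl _)⟩
        · exact absurd hbu (not_le.2 h4)
        · exact ⟨⟨h2 ▸ hlo, fun _ => h4.2⟩, fun _ => h4.1⟩
      · rintro ⟨⟨h1, h2⟩, h3⟩
        constructor
        · by_cases e : a u = hi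
          · refine Or.inr ⟨e, ?_⟩
            by_cases e' : b u = lo'
            · exact Or.inr ⟨e', zero_le⟩
            · exact Or.inl (injq _ _ hbu (Ne.symm e'))
          · exact Or.inl (injp _ _ (hhimax _ h1) e)
        · by_cases e : a u = lo
          · exact Or.inr ⟨e, Or.inr ⟨h3 e, h2 e⟩⟩
          · exact Or.inl (injp _ _ (hlomin _ h1) (Ne.symm e))
    refine ⟨M.map Function.Embedding.inr,
      fun r => if r = Sum.inr lo' then coordY p q hi lo' 0 else
        Sum.elim (fun _ => coordY p q 0 0 0) (fun β => coordY p q lo β 0) r,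
      fun r => if r = Sum.inr lo' then coordZ p q lo lo' i else
        Sum.elim (fun _ => coordZ p q 0 0 0) (fun β => coordZ p q lo β i) r,
      by simp, fun u => ?_⟩
    simp only [Finset.mem_map, Function.Embedding.inr_apply, exists_exists_and_eq_and,
      Sum.elim_inr, Sum.inr.injEq, he]
    have hq0 : u ≡ μ [MOD q ^ 0] := by simp [Nat.modEq_one]
    constructor
    · rintro ⟨h, -⟩
      by_cases e : a u = lo → b u = lo'
      · refine ⟨lo', ((memJ lo').1 hlo').1, ?_⟩
        rw [if_pos rfl, if_pos rfl]
        exact (hrun u).2 ⟨h, e⟩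
      · push Not at e
        refine ⟨b u, (hb u).1, ?_⟩
        rw [if_neg e.2, if_neg e.2]
        exact (hblock _ (hJM _ (hb u).1) u).2 ⟨e.1, rfl, h, hq0⟩
    · rintro ⟨β, hβ, h⟩
      refine ⟨?_, hq0⟩
      by_cases e : β = lo'
      · rw [if_pos e, if_pos e] at h
        exact ((hrun u).1 h).1
      · rw [if_neg e, if_neg e] at h
        exact ((hblock β (hJM _ hβ) u).1 h).2.2.1
  · refine ⟨(I.erase lo).disjSum J, Sum.elim (fun α => coordY p q α lo' j)
        fun β => coordY p q lo β ((if β = lo' then j else 0 : ℕ) : ℕ∞),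
      Sum.elim (fun α => coordZ p q α hi' 0) fun β => coordZ p q lo β i, ?_, fun u => ?_⟩
    · -- The two classes share only `μ`, since `M` is separated modulo `p * q`.
      have h1 : I ∩ J ⊆ {μ} := by
        intro x hx
        rw [Finset.mem_inter, memI, memJ] at hx
        rw [Finset.mem_singleton]
        refine hM x hx.1.1 μ hμ ((Nat.modEq_and_modEq_iff_modEq_mul hpq).1 ⟨?_, ?_⟩)
        · exact hx.1.2.of_dvd (dvd_pow_self p hipos.ne')
        · exact hx.2.2.of_dvd (dvd_pow_self q hjpos.ne')
      have h2 := Finset.card_le_card h1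
      have h3 := Finset.card_union_add_card_inter I J
      have h4 : (I ∪ J).card ≤ M.card := Finset.card_le_card
        (Finset.union_subset (Finset.filter_subset _ _) (Finset.filter_subset _ _))
      have h5 := Finset.card_pos.2 ⟨μ, hμI⟩
      rw [Finset.card_disjSum, Finset.card_erase_of_mem hlo]
      rw [Finset.card_singleton] at h2
      omega
    · rw [he]
      constructor
      · rintro ⟨h1, h2⟩
        by_cases e : a u = lo
        · have h3 := ((heq u).1 h2).1
          exact ⟨Sum.inr (b u), by simpa using h3, (hblock _ h3 u).2 ⟨e, rfl, h1, h2⟩⟩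
        · exact ⟨Sum.inl (a u), by simpa using ⟨e, ((hep u).1 h1).1⟩, (hcol _ u).2 ⟨rfl, h2⟩⟩
      · rintro ⟨α | β, hr, h⟩
        · have hα : α ≠ lo ∧ α ∈ I := by simpa using hr
          obtain ⟨rfl, h2⟩ := (hcol α u).1 h
          exact ⟨(hep u).2 ⟨hα.2, fun e => absurd e hα.1⟩, h2⟩
        · exact ((hblock β (by simpa using hr) u).1 h).2.2

theorem mInfiniteAP_le_of_finset {k p q : ℕ} (hk : 1 ≤ k) (hpq : Nat.Coprime p q) {M : Finset ℕ}
    (hM : ∀ a ∈ M, ∀ b ∈ M, a ≡ b [MOD p * q] → a = b) (hne : M.Nonempty) :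
    mInfiniteAP {d | ∃ i j : ℕ, d = p ^ i * q ^ j} M k ≤ M.card * (mOctant k - 1) + 1 := by
  classical
  rcases mParam_eq_top_or octantFamily k with htop | ⟨m, hm, hmeq, hc⟩
  · rw [mOctant, htop, ENat.top_sub_one, ENat.mul_top (by simpa using hne.ne_empty)]
    simp
  have hcast : (M.card : ℕ∞) * (mOctant k - 1) + 1 = ((M.card * (m - 1) + 1 : ℕ) : ℕ∞) := by
    rw [mOctant, hmeq]; push_cast; rfl
  rw [hcast]
  refine mParam_le (Nat.le_add_left _ _)
    (colorableAt_of_finset (fun H hH => hH.1) fun H hH => ?_)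
  obtain ⟨hfin, hedge⟩ := hH
  choose a ha using exists_isNearest p hne
  choose b hb using exists_isNearest q hne
  obtain ⟨c, hc⟩ := hc.exists_coloring hk hfin.toFinset (fun n => n)
    (fun u => coordY p q (a u) (b u) (closeness q u (b u)))
    (fun u => coordZ p q (a u) (b u) (closeness p u (a u))) (fun _ _ _ _ h => h)
  refine ⟨c, fun T hT hmT s => ?_⟩
  obtain ⟨x, d, ⟨i, j, rfl⟩, ⟨r, μ, hμ, rfl⟩, hTe⟩ := hedge T hT
  obtain ⟨P, Y, Z, hP, hPe⟩ := exists_octants_cover hpq hM ha hb hμ i j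
  have hmem : ∀ n, n ∈ T ↔ (μ + r * (p ^ i * q ^ j) ≤ n ∧ n ≡ μ [MOD p ^ i * q ^ j]) ∧
      n ∈ hfin.toFinset := by
    intro n
    have hμr : μ + r * (p ^ i * q ^ j) ≡ μ [MOD p ^ i * q ^ j] := by simp [Nat.ModEq]
    rw [← Finset.mem_coe, hTe, Set.mem_inter_iff, mem_infiniteAP_iff, Set.Finite.mem_toFinset]
    exact and_congr_left fun _ => and_congr_right fun _ =>
      ⟨fun h => h.trans hμr, fun h => h.trans hμr.symm⟩
  obtain ⟨t, ht, hmt⟩ := exists_le_card_of_cover P (fun t => hfin.toFinset.filter fun u =>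
      μ + r * (p ^ i * q ^ j) ≤ u ∧ coordY p q (a u) (b u) (closeness q u (b u)) ≤ Y t ∧
        coordZ p q (a u) (b u) (closeness p u (a u)) ≤ Z t) hP hmT fun u hu => by
    obtain ⟨⟨h1, h2⟩, h3⟩ := (hmem u).1 hu
    obtain ⟨t, ht, h4⟩ := (hPe u).1 h2
    exact ⟨t, ht, Finset.mem_filter.2 ⟨h3, h1, h4⟩⟩
  obtain ⟨v, hvS, ⟨hv1, hv2⟩, hvs⟩ := hc _ _ _ hmt s
  exact ⟨v, (hmem v).2 ⟨⟨hv1, (hPe v).2 ⟨t, ht, hv2⟩⟩, hvS⟩, hvs⟩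

theorem mInfiniteAP_pow_mul_pow_le {k p q : ℕ} (hk : 1 ≤ k) (hp : 1 ≤ p) (hq : 1 ≤ q)
    (hpq : Nat.Coprime p q) {M : Set ℕ}
    (hM : ∀ a ∈ M, ∀ b ∈ M, a ≡ b [MOD p * q] → a = b) :
    mInfiniteAP {d | ∃ i j : ℕ, d = p ^ i * q ^ j} M k ≤ M.encard * (mOctant k - 1) + 1 := by
  have hfin : M.Finite := Set.Finite.of_injOn (f := fun a => a % (p * q))
    (t := Set.Iio (p * q)) (fun a _ => Nat.mod_lt _ (Nat.mul_pos hp hq))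
    (fun a ha b hb h => hM a ha b hb h) (Set.finite_Iio _)
  rcases M.eq_empty_or_nonempty with rfl | hne
  · -- Without bases there are no edges.
    rw [Set.encard_empty, zero_mul, zero_add]
    refine mParam_le le_rfl fun H hH => ⟨fun _ => ⟨0, hk⟩, fun e he => ?_⟩
    obtain ⟨_, _, _, ⟨_, _, h, _⟩, _⟩ := hH.2 e he.1
    exact absurd h (Set.notMem_empty _)
  · lift M to Finset ℕ using hfin
    rw [Set.encard_coe_eq_coe_finsetCard]
    exact mInfiniteAP_le_of_finset hk hpq hM (by simpa using hne)

/-! ### Encoding orders by divisibility -/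

section StrictRank

variable {α Y : Type*} [LinearOrder Y]

/-- The number of elements of `S` whose `f`-value is less than `y`. -/
def strictRank (S : Finset α) (f : α → Y) (y : Y) : ℕ := (S.filter fun s => f s < y).card

theorem strictRank_le_card (S : Finset α) (f : α → Y) (y : Y) : strictRank S f y ≤ S.card :=
  Finset.card_filter_le _ _

theorem strictRank_lt_of_lt {S : Finset α} {f : α → Y} {v : α} (hv : v ∈ S) {y : Y} (h : f v < y) :
    strictRank S f (f v) < strictRank S f y := by
  refine Finset.card_lt_card ?_
  rw [Finset.ssubset_iff_of_subset
    (Finset.monotone_filter_right S fun s _ hs => lt_trans hs h)]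
  exact ⟨v, by simp [hv, h], by simp⟩

theorem strictRank_mono (S : Finset α) (f : α → Y) : Monotone (strictRank S f) :=
  fun _ _ h => Finset.card_le_card (Finset.monotone_filter_right S fun _ _ hs => lt_of_lt_of_le hs h)

theorem strictRank_le_strictRank_iff {S : Finset α} {f : α → Y} {v : α} (hv : v ∈ S) (y : Y) :
    strictRank S f y ≤ strictRank S f (f v) ↔ y ≤ f v :=
  ⟨fun h => le_of_not_gt fun hlt => absurd h (not_le.2 (strictRank_lt_of_lt hv hlt)),
    fun h => strictRank_mono S f h⟩

end StrictRank

section Encode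

variable {ι : Type*} [Fintype ι]

/-- A number whose divisibility by powers of the `p l` is governed by the exponents `g l` and
whose size is governed by `e`. -/
def encode (p g : ι → ℕ) (e : ℕ) : ℕ := (∏ l, p l ^ g l) * ((∏ l, p l) ^ e + 1)

theorem pow_dvd_encode_iff {p : ι → ℕ} (hp : ∀ l, 2 ≤ p l)
    (hcop : Pairwise fun l l' => Nat.Coprime (p l) (p l')) (g : ι → ℕ) {e : ℕ} (he : 1 ≤ e)
    (l : ι) (i : ℕ) : p l ^ i ∣ encode p g e ↔ i ≤ g l := by
  classical
  have hsplit : encode p g e = p l ^ g l *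
      ((∏ l' ∈ Finset.univ.erase l, p l' ^ g l') * ((∏ l, p l) ^ e + 1)) := by
    rw [encode, ← Finset.mul_prod_erase Finset.univ _ (Finset.mem_univ l), mul_assoc]
  have h1 : Nat.Coprime (p l) (∏ l' ∈ Finset.univ.erase l, p l' ^ g l') :=
    Nat.Coprime.prod_right fun l' hl' => (hcop (Finset.ne_of_mem_erase hl').symm).pow_right _
  have h2 : Nat.Coprime (p l) ((∏ l, p l) ^ e + 1) := by
    obtain ⟨r, hr⟩ : p l ∣ (∏ l, p l) ^ e :=
      (Finset.dvd_prod_of_mem p (Finset.mem_univ l)).trans (dvd_pow_self _ (by omega))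
    rw [hr]
    simp
  rw [hsplit]
  constructor
  · intro h
    exact (Nat.pow_dvd_pow_iff_le_right (hp l)).1
      (((h1.mul_right h2).pow_left i).dvd_of_dvd_mul_right h)
  · intro h
    exact (pow_dvd_pow _ h).mul_right _

theorem prod_pow_dvd_encode_iff {p : ι → ℕ} (hp : ∀ l, 2 ≤ p l)
    (hcop : Pairwise fun l l' => Nat.Coprime (p l) (p l')) (g : ι → ℕ) {e : ℕ} (he : 1 ≤ e)
    (i : ι → ℕ) : ∏ l, p l ^ i l ∣ encode p g e ↔ ∀ l, i l ≤ g l := by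
  simp only [← pow_dvd_encode_iff hp hcop g he]
  constructor
  · intro h l
    exact (Finset.dvd_prod_of_mem (fun l => p l ^ i l) (Finset.mem_univ l)).trans h
  · intro h
    refine Fintype.prod_dvd_of_isRelPrime (fun l l' hl => ?_) h
    exact Nat.coprime_iff_isRelPrime.1 ((hcop hl).pow _ _)

theorem prod_pow_le_pow {p g : ι → ℕ} (hp : ∀ l, 2 ≤ p l) {N : ℕ} (hg : ∀ l, g l ≤ N) :
    ∏ l, p l ^ g l ≤ (∏ l, p l) ^ N := by
  rw [← Finset.prod_pow]
  exact Finset.prod_le_prod' fun l _ => Nat.pow_le_pow_right (by have := hp l; omega) (hg l)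

/-- Divisibility by `∏ l, p l ^ i l` and size together encode lower bounds on arbitrary
coordinates: if the arithmetic progressions with base `0` are colorable at `m`, so is every system
of sets cut out by lower bounds on `x` and on all the `A l`. The size of such a set is bounded from
below by exhibiting a subset `T` with at least `m` elements. -/
theorem ColorableAt.exists_coloring_of_infiniteAP [Nonempty ι] {m k : ℕ} (hk : 1 ≤ k)
    {D : Set ℕ} (hc : ColorableAt (infiniteAPFamily D {0}) m k) {p : ι → ℕ} (hp : ∀ l, 2 ≤ p l)
    (hcop : Pairwise fun l l' => Nat.Coprime (p l) (p l')) (hD : ∀ i : ι → ℕ, ∏ l, p l ^ i l ∈ D)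
    {α X Y : Type*} [LinearOrder X] [LinearOrder Y] (V : Finset α) (x : α → X) (A : ι → α → Y)
    (hinj : ∀ v ∈ V, ∀ w ∈ V, x v = x w → (∀ l, A l v = A l w) → v = w) :
    ∃ c : α → Fin k, ∀ (X₀ : X) (Y₀ : ι → Y) (T : Finset α), m ≤ T.card →
      (∀ v ∈ T, v ∈ V ∧ X₀ ≤ x v ∧ ∀ l, Y₀ l ≤ A l v) →
      ∀ i, ∃ v ∈ V, (X₀ ≤ x v ∧ ∀ l, Y₀ l ≤ A l v) ∧ c v = i := by
  classical
  set N := V.card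
  set Q := ∏ l, p l with hQ
  have hQ2 : 2 ≤ Q := by
    obtain ⟨l⟩ := ‹Nonempty ι›
    exact (hp l).trans (Nat.le_of_dvd (Finset.prod_pos fun l _ => by have := hp l; omega)
      (Finset.dvd_prod_of_mem p (Finset.mem_univ l)))
  -- Consecutive sizes are spread out by a factor that exceeds all the products `∏ l, p l ^ g l`.
  let E : X → ℕ := fun t => (N + 1) * (strictRank V x t + 1)
  let g : α → ι → ℕ := fun v l => strictRank V (A l) (A l v)
  let f : α → ℕ := fun v => encode p (g v) (E (x v))
  have hE : ∀ t, N + 1 ≤ E t := fun t => Nat.le_mul_of_pos_right _ (Nat.succ_pos _)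
  have hgN : ∀ v l, g v l ≤ N := fun v l => strictRank_le_card _ _ _
  have hdvd : ∀ (v : α) (i : ι → ℕ), ∏ l, p l ^ i l ∣ f v ↔ ∀ l, i l ≤ g v l := fun v i =>
    prod_pow_dvd_encode_iff hp hcop _ (by have := hE (x v); omega) i
  have hlow : ∀ v t, t ≤ x v → Q ^ E t ≤ f v := by
    intro v t ht
    have h1 : E t ≤ E (x v) :=
      Nat.mul_le_mul_left _ (Nat.add_le_add_right (strictRank_mono V x ht) 1)
    have h2 : 1 ≤ ∏ l, p l ^ g v l :=
      Finset.prod_pos fun l _ => Nat.pow_pos (by have := hp l; omega)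
    calc Q ^ E t ≤ Q ^ E (x v) := Nat.pow_le_pow_right (by omega) h1
      _ ≤ Q ^ E (x v) + 1 := Nat.le_succ _
      _ ≤ f v := Nat.le_mul_of_pos_left _ h2
  have hup : ∀ v ∈ V, ∀ t, x v < t → f v < Q ^ E t := by
    intro v hv t ht
    have h1 : E (x v) + (N + 1) ≤ E t := by
      have := strictRank_lt_of_lt hv ht
      calc E (x v) + (N + 1) = (N + 1) * (strictRank V x (x v) + 1 + 1) := by
            simp only [E]; ring
        _ ≤ E t := Nat.mul_le_mul_left _ (by omega)
    have h3 : 1 < Q ^ E (x v) := Nat.one_lt_pow (by have := hE (x v); omega) (by omega)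
    calc f v ≤ Q ^ N * (Q ^ E (x v) + 1) :=
          Nat.mul_le_mul_right _ (prod_pow_le_pow hp (hgN v))
      _ < Q ^ N * (Q ^ E (x v) * Q) := by
          refine Nat.mul_lt_mul_of_pos_left ?_ (Nat.pow_pos (by omega))
          nlinarith
      _ = Q ^ (E (x v) + (N + 1)) := by ring
      _ ≤ Q ^ E t := Nat.pow_le_pow_right (by omega) h1
  have hsize : ∀ v ∈ V, ∀ t, Q ^ E t ≤ f v ↔ t ≤ x v := fun v hv t =>
    ⟨fun h => le_of_not_gt fun hlt => absurd h (not_le.2 (hup v hv t hlt)), hlow v t⟩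
  have hf : Set.InjOn f V := by
    intro v hv w hw hvw
    refine hinj v hv w hw (le_antisymm ?_ ?_) fun l => ?_
    · rw [← hsize w hw, ← hvw, hsize v hv]
    · rw [← hsize v hv, hvw, hsize w hw]
    · have h1 := (hdvd v (g v)).2 fun _ => le_rfl
      have h2 := (hdvd w (g w)).2 fun _ => le_rfl
      rw [hvw, hdvd] at h1
      rw [← hvw, hdvd] at h2
      exact le_antisymm ((strictRank_le_strictRank_iff hw _).1 (h1 l))
        ((strictRank_le_strictRank_iff hv _).1 (h2 l))
  let H : Hypergraph ℕ :=
    { vertexSet := f '' V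
      edgeSet := {e | ∃ a : ℕ, ∃ d ∈ D, (∃ r : ℕ, ∃ μ ∈ ({0} : Set ℕ), a = μ + r * d) ∧
        e = infiniteAP a d ∩ f '' V}
      subset_vertexSet_of_mem_edgeSet' := by
        rintro e ⟨_, _, _, _, rfl⟩
        exact Set.inter_subset_right }
  obtain ⟨c, hc⟩ := hc H ⟨V.finite_toSet.image f, fun e he => he⟩
  refine ⟨fun v => if hv : v ∈ V then c ⟨f v, v, hv, rfl⟩ else ⟨0, hk⟩, ?_⟩
  intro X₀ Y₀ T hmT hT s
  have hm : m ≤ (V.filter fun v => X₀ ≤ x v ∧ ∀ l, Y₀ l ≤ A l v).card :=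
    hmT.trans (Finset.card_le_card fun v hv => Finset.mem_filter.2 (hT v hv))
  let i : ι → ℕ := fun l => strictRank V (A l) (Y₀ l)
  have hdT : ∏ l, p l ^ i l ∣ Q ^ E X₀ := by
    rw [hQ, ← Finset.prod_pow]
    refine Finset.prod_dvd_prod_of_dvd _ _ fun l _ => pow_dvd_pow _ ?_
    have h1 : i l ≤ N := strictRank_le_card _ _ _
    have h2 := hE X₀
    omega
  have key : infiniteAP (Q ^ E X₀) (∏ l, p l ^ i l) ∩ f '' V
      = f '' (V.filter fun v => X₀ ≤ x v ∧ ∀ l, Y₀ l ≤ A l v : Finset α) := by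
    have mem : ∀ v ∈ V, f v ∈ infiniteAP (Q ^ E X₀) (∏ l, p l ^ i l) ↔
        X₀ ≤ x v ∧ ∀ l, Y₀ l ≤ A l v := by
      intro v hv
      rw [mem_infiniteAP_iff, hsize v hv]
      refine and_congr_right fun _ => ?_
      have h0 : Q ^ E X₀ ≡ 0 [MOD ∏ l, p l ^ i l] := (Nat.modEq_zero_iff_dvd).2 hdT
      have h1 : f v ≡ Q ^ E X₀ [MOD ∏ l, p l ^ i l] ↔ ∏ l, p l ^ i l ∣ f v :=
        ⟨fun h => Nat.modEq_zero_iff_dvd.1 (h.trans h0),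
          fun h => (Nat.modEq_zero_iff_dvd.2 h).trans h0.symm⟩
      rw [h1, hdvd]
      exact forall_congr' fun l => strictRank_le_strictRank_iff hv _
    ext r
    constructor
    · rintro ⟨hr, v, hv, rfl⟩
      exact ⟨v, by simpa using ⟨hv, (mem v hv).1 hr⟩, rfl⟩
    · rintro ⟨v, hv, rfl⟩
      have hv' := Finset.mem_filter.1 (Finset.mem_coe.1 hv)
      exact ⟨(mem v hv'.1).2 hv'.2, v, hv'.1, rfl⟩
  obtain ⟨r₀, hr₀⟩ := hdT
  obtain ⟨⟨r, hrH⟩, hr, hri⟩ := hc _ ⟨⟨Q ^ E X₀, _, hD i,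
      ⟨r₀, 0, rfl, by rw [hr₀, zero_add, mul_comm]⟩, rfl⟩, by
    rw [key, Set.InjOn.encard_image (hf.mono fun v hv =>
      (Finset.mem_filter.1 (Finset.mem_coe.1 hv)).1), Set.encard_coe_eq_coe_finsetCard]
    exact_mod_cast hm⟩ s
  change r ∈ infiniteAP (Q ^ E X₀) (∏ l, p l ^ i l) ∩ f '' V at hr
  rw [key] at hr
  obtain ⟨v, hv, rfl⟩ := hr
  have hv' := Finset.mem_filter.1 (Finset.mem_coe.1 hv)
  exact ⟨v, hv'.1, hv'.2, by simpa [hv'.1] using hri⟩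

end Encode

theorem mOctant_le_mInfiniteAP {k p q : ℕ} (hk : 1 ≤ k) (hp : 2 ≤ p) (hq : 2 ≤ q)
    (hpq : Nat.Coprime p q) :
    mOctant k ≤ mInfiniteAP {d | ∃ i j : ℕ, d = p ^ i * q ^ j} {0} k := by
  refine mParam_le_mParam fun m hm hc => colorableAt_of_finset (fun H hH => hH.1) fun H hH => ?_
  obtain ⟨hfin, hedge⟩ := hH
  obtain ⟨c, hc⟩ := hc.exists_coloring_of_infiniteAP hk (p := ![p, q])
    (by simp [Fin.forall_fin_two, hp, hq])
    (by
      intro l l' h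
      fin_cases l <;> fin_cases l' <;>
        first | exact absurd rfl h | exact hpq | exact hpq.symm)
    (fun i => ⟨i 0, i 1, by simp⟩) hfin.toFinset
    (fun P : ℝ × ℝ × ℝ => P.1) ![fun P => -P.2.1, fun P => -P.2.2] (by
      rintro ⟨x, y, z⟩ - ⟨x', y', z'⟩ - h1 h2
      simpa [Fin.forall_fin_two, h1] using And.intro h1 h2)
  refine ⟨c, fun T hT hmT s => ?_⟩
  obtain ⟨x₀, y₀, z₀, hTe⟩ := hedge T hT
  have hmem : ∀ P, P ∈ T ↔ P ∈ hfin.toFinset ∧ x₀ ≤ P.1 ∧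
      ∀ l, (![-y₀, -z₀] : Fin 2 → ℝ) l ≤
        (![fun P => -P.2.1, fun P => -P.2.2] : Fin 2 → ℝ × ℝ × ℝ → ℝ) l P := by
    intro P
    rw [← Finset.mem_coe, hTe]
    simp [octant, Fin.forall_fin_two]
  obtain ⟨v, hv, hv', hvs⟩ := hc x₀ ![-y₀, -z₀] T hmT (fun P hP => (hmem P).1 hP) s
  exact ⟨v, (hmem v).2 ⟨hv, hv'⟩, hvs⟩

/-! ### Three coprime factors: complete `m`-ary trees -/

/-- The nodes of the complete `m`-ary tree of depth `m` below its root: `(l, w)` with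
`w < m ^ l` is the `w`-th node of level `l`, and its children are the `(l + 1, m * w + i)` with
`i < m`. -/
def treeNodes (m : ℕ) : Finset (ℕ × ℕ) :=
  (Finset.Icc 1 m ×ˢ Finset.range (m ^ m)).filter fun v => v.2 < m ^ v.1

theorem mem_treeNodes {m : ℕ} {v : ℕ × ℕ} :
    v ∈ treeNodes m ↔ 1 ≤ v.1 ∧ v.1 ≤ m ∧ v.2 < m ^ v.1 := by
  simp only [treeNodes, Finset.mem_filter, Finset.mem_product, Finset.mem_Icc, Finset.mem_range]
  constructor
  · rintro ⟨⟨⟨h1, h2⟩, -⟩, h3⟩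
    exact ⟨h1, h2, h3⟩
  · rintro ⟨h1, h2, h3⟩
    exact ⟨⟨⟨h1, h2⟩, h3.trans_le (Nat.pow_le_pow_right (by omega) h2)⟩, h3⟩

/-- If among the children of every node there is one with the property `R`, then there is a path
from the root to a leaf all of whose nodes have the property `R`. -/
theorem exists_path {m : ℕ} (R : ℕ × ℕ → Prop)
    (h : ∀ l w, l < m → w < m ^ l → ∃ i < m, R (l + 1, m * w + i)) (n : ℕ) (hn : n ≤ m) :
    ∃ w < m ^ n, ∀ l, 1 ≤ l → l ≤ n → R (l, w / m ^ (n - l)) := by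
  induction n with
  | zero => exact ⟨0, by simp, fun l h1 h2 => by omega⟩
  | succ n ih =>
    obtain ⟨w, hw, hwR⟩ := ih (by omega)
    obtain ⟨i, him, hi⟩ := h n w (by omega) hw
    refine ⟨m * w + i, ?_, fun l h1 h2 => ?_⟩
    · calc m * w + i < m * (w + 1) := by rw [mul_add]; omega
        _ ≤ m * m ^ n := Nat.mul_le_mul_left _ hw
        _ = m ^ (n + 1) := by ring
    · rcases Nat.lt_or_ge n l with hl | hl
      · obtain rfl : l = n + 1 := by omega
        simpa using hi
      · have h3 : (m * w + i) / m ^ (n + 1 - l) = w / m ^ (n - l) := by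
          rw [show n + 1 - l = (n - l) + 1 by omega, pow_succ', ← Nat.div_div_eq_div_mul,
            Nat.mul_add_div (by omega), Nat.div_eq_of_lt him, add_zero]
        rw [h3]
        exact hwR l h1 hl

/-- Sets of siblings are intervals of the breadth-first order of the nodes, which takes two
coordinates, and paths from the root to a leaf are the sets of nodes whose interval of
descendant leaves contains a given leaf, which takes two more. -/
theorem not_colorableAt {p₁ p₂ p₃ k m : ℕ} (h₁ : 2 ≤ p₁) (h₂ : 2 ≤ p₂) (h₃ : 2 ≤ p₃)
    (h₁₂ : Nat.Coprime p₁ p₂) (h₁₃ : Nat.Coprime p₁ p₃) (h₂₃ : Nat.Coprime p₂ p₃) (hk : 2 ≤ k)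
    (hm : 1 ≤ m) :
    ¬ ColorableAt (infiniteAPFamily
      {d | ∃ j₁ j₂ j₃ : ℕ, d = p₁ ^ j₁ * p₂ ^ j₂ * p₃ ^ j₃} {0}) m k := by
  classical
  intro hc
  let bfs : ℕ × ℕ → ℕ := fun v => v.1 * m ^ m + v.2
  let lo : ℕ × ℕ → ℕ := fun v => v.2 * m ^ (m - v.1)
  let hi : ℕ × ℕ → ℕ := fun v => (v.2 + 1) * m ^ (m - v.1)
  have hwB : ∀ v ∈ treeNodes m, v.2 < m ^ m := fun v hv =>
    (mem_treeNodes.1 hv).2.2.trans_le (Nat.pow_le_pow_right hm (mem_treeNodes.1 hv).2.1)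
  have hdiv : ∀ l w, w < m ^ m → (l * m ^ m + w) / m ^ m = l := by
    intro l w hw
    rw [mul_comm, Nat.mul_add_div (by omega), Nat.div_eq_of_lt hw, add_zero]
  obtain ⟨c, hc⟩ := hc.exists_coloring_of_infiniteAP (by omega) (p := ![p₁, p₂, p₃])
    (by simp [Fin.forall_fin_succ, h₁, h₂, h₃])
    (by
      intro l l' h
      fin_cases l <;> fin_cases l' <;>
        first | exact absurd rfl h | exact h₁₂ | exact h₁₃ | exact h₂₃ | exact h₁₂.symm |
          exact h₁₃.symm | exact h₂₃.symm)
    (fun i => ⟨i 0, i 1, i 2, by simp [Fin.prod_univ_succ, mul_assoc]⟩) (treeNodes m)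
    bfs ![fun v => -(bfs v : ℤ), fun v => -(lo v : ℤ), fun v => (hi v : ℤ)] (by
      intro v hv w hw h _
      have h1 : v.1 = w.1 := by
        rw [← hdiv v.1 v.2 (hwB v hv), ← hdiv w.1 w.2 (hwB w hw)]
        exact congrArg (· / m ^ m) h
      refine Prod.ext h1 ?_
      simp only [bfs, h1] at h
      omega)
  have hmem : ∀ (X₀ : ℕ) (Y₁ Y₂ Y₃ : ℤ) (v : ℕ × ℕ), (X₀ ≤ bfs v ∧
      ∀ l, (![Y₁, Y₂, Y₃] : Fin 3 → ℤ) l ≤ (![fun v => -(bfs v : ℤ), fun v => -(lo v : ℤ),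
        fun v => (hi v : ℤ)] : Fin 3 → ℕ × ℕ → ℤ) l v) ↔
      X₀ ≤ bfs v ∧ Y₁ ≤ -(bfs v : ℤ) ∧ Y₂ ≤ -(lo v : ℤ) ∧ Y₃ ≤ hi v := by
    intro X₀ Y₁ Y₂ Y₃ v
    simp [Fin.forall_fin_succ]
  have hlo : ∀ v ∈ treeNodes m, lo v ≤ m ^ m := by
    intro v hv
    have hv' := mem_treeNodes.1 hv
    calc lo v ≤ m ^ v.1 * m ^ (m - v.1) := Nat.mul_le_mul_right _ hv'.2.2.le
      _ = m ^ m := by rw [← pow_add]; congr 1; omega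
  -- Every set of siblings contains a node of the first color.
  have hsib : ∀ l w, l < m → w < m ^ l → ∃ i < m, c (l + 1, m * w + i) = ⟨0, by omega⟩ := by
    intro l w hl hw
    have hwm : m * w + m ≤ m ^ (l + 1) := by
      calc m * w + m = m * (w + 1) := by ring
        _ ≤ m * m ^ l := Nat.mul_le_mul_left _ hw
        _ = m ^ (l + 1) := by ring
    have hwm' : m ^ (l + 1) ≤ m ^ m := Nat.pow_le_pow_right hm hl
    obtain ⟨v, hvV, hv, hv0⟩ := hc ((l + 1) * m ^ m + m * w)
      ![-(((l + 1) * m ^ m + m * w + (m - 1) : ℕ) : ℤ), -((m ^ m : ℕ) : ℤ), 0]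
      ((Finset.range m).image fun i => (l + 1, m * w + i)) (by
        rw [Finset.card_image_of_injective _ (fun a b h => by simpa using h), Finset.card_range])
      (fun v hv => by
        obtain ⟨i, hi', rfl⟩ := Finset.mem_image.1 hv
        have him := Finset.mem_range.1 hi'
        have hn : (l + 1, m * w + i) ∈ treeNodes m :=
          mem_treeNodes.2 ⟨by simp, hl, by simp only; omega⟩
        refine ⟨hn, (hmem _ _ _ _ _).2 ⟨?_, ?_, ?_, ?_⟩⟩
        · simp only [bfs]; omega
        · rw [neg_le_neg_iff, Nat.cast_le]
          simp only [bfs]; omega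
        · rw [neg_le_neg_iff, Nat.cast_le]
          exact hlo _ hn
        · exact Int.natCast_nonneg _) ⟨0, by omega⟩
    obtain ⟨h1, h2, -, -⟩ := (hmem _ _ _ _ _).1 hv
    rw [neg_le_neg_iff, Nat.cast_le] at h2
    simp only [bfs] at h1 h2
    have hv1 : v.1 = l + 1 := by
      refine le_antisymm ?_ ?_
      · have := Nat.div_le_div_right (c := m ^ m) h2
        rwa [hdiv _ _ (hwB v hvV), add_assoc, hdiv _ _ (by omega)] at this
      · have := Nat.div_le_div_right (c := m ^ m) h1
        rwa [hdiv _ _ (hwB v hvV), hdiv _ _ (by omega)] at this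
    rw [hv1] at h1 h2
    refine ⟨v.2 - m * w, by omega, ?_⟩
    rw [← hv0]
    congr 1
    refine Prod.ext hv1.symm ?_
    simp only
    omega
  obtain ⟨W, hW, hpath⟩ := exists_path (fun v => c v = ⟨0, by omega⟩) hsib m le_rfl
  -- The path to the leaf `W` has only the first color.
  have hpos : ∀ l, 0 < m ^ (m - l) := fun l => Nat.pow_pos hm
  obtain ⟨v, hvV, hv, hv1⟩ := hc 0
    ![-(((m + 1) * m ^ m : ℕ) : ℤ), -(W : ℤ), ((W + 1 : ℕ) : ℤ)]
    ((Finset.Icc 1 m).image fun l => (l, W / m ^ (m - l))) (by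
      rw [Finset.card_image_of_injective _ (fun a b h => (Prod.ext_iff.1 h).1), Nat.card_Icc]
      omega)
    (fun v hv => by
      obtain ⟨l, hl, rfl⟩ := Finset.mem_image.1 hv
      rw [Finset.mem_Icc] at hl
      have hn : (l, W / m ^ (m - l)) ∈ treeNodes m := by
        refine mem_treeNodes.2 ⟨hl.1, hl.2, ?_⟩
        rw [Nat.div_lt_iff_lt_mul (hpos l), ← pow_add, Nat.add_sub_cancel' hl.2]
        exact hW
      refine ⟨hn, (hmem _ _ _ _ _).2 ⟨Nat.zero_le _, ?_, ?_, ?_⟩⟩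
      · rw [neg_le_neg_iff, Nat.cast_le]
        have h1 := hwB _ hn
        have h2 := Nat.mul_le_mul_right (m ^ m) hl.2
        simp only [bfs, add_mul, one_mul] at *
        omega
      · rw [neg_le_neg_iff, Nat.cast_le]
        exact Nat.div_mul_le_self _ _
      · rw [Nat.cast_le, Nat.succ_le_iff]
        simp only [hi]
        rw [add_mul, one_mul]
        exact Nat.lt_div_mul_add (hpos l)) ⟨1, hk⟩
  obtain ⟨-, -, h2, h3⟩ := (hmem _ _ _ _ _).1 hv
  rw [neg_le_neg_iff, Nat.cast_le] at h2
  rw [Nat.cast_le] at h3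
  have hvV' := mem_treeNodes.1 hvV
  have hvW : W / m ^ (m - v.1) = v.2 := by
    have h4 := hpos v.1
    simp only [lo, hi, add_mul, one_mul] at h2 h3
    rw [Nat.div_eq_iff h4]
    omega
  have hcol := hpath v.1 hvV'.1 hvV'.2.1
  rw [hvW, Prod.mk.eta, hv1] at hcol
  simp at hcol

theorem mInfiniteAP_three_eq_top {p₁ p₂ p₃ k : ℕ} (h₁ : 2 ≤ p₁) (h₂ : 2 ≤ p₂) (h₃ : 2 ≤ p₃)
    (h₁₂ : Nat.Coprime p₁ p₂) (h₁₃ : Nat.Coprime p₁ p₃) (h₂₃ : Nat.Coprime p₂ p₃) (hk : 2 ≤ k) :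
    mInfiniteAP {d | ∃ j₁ j₂ j₃ : ℕ, d = p₁ ^ j₁ * p₂ ^ j₂ * p₃ ^ j₃} {0} k = ⊤ := by
  rcases mParam_eq_top_or (infiniteAPFamily
      {d | ∃ j₁ j₂ j₃ : ℕ, d = p₁ ^ j₁ * p₂ ^ j₂ * p₃ ^ j₃} {0}) k with h | ⟨m, hm, -, hc⟩
  · exact h
  · exact absurd hc (not_colorableAt h₁ h₂ h₃ h₁₂ h₁₃ h₂₃ hk hm)

end Polychromatic

open Polychromatic in
theorem theorem6 (k : ℕ) (hk : 1 ≤ k) :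
    (∀ t : ℕ, 2 ≤ t →
      mInfiniteAP {d | ∃ i : ℕ, d = t ^ i} Set.univ k ≤ mOctant k) ∧
    (∀ p q : ℕ, 1 ≤ p → 1 ≤ q → Nat.Coprime p q →
      ∀ M : Set ℕ, (∀ a ∈ M, ∀ b ∈ M, a ≡ b [MOD p * q] → a = b) →
        mInfiniteAP {d | ∃ i j : ℕ, d = p ^ i * q ^ j} M k
            ≤ M.encard * (mOctant k - 1) + 1 ∧
        (M = {0} → 2 ≤ p → 2 ≤ q →
          mInfiniteAP {d | ∃ i j : ℕ, d = p ^ i * q ^ j} M k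
            = M.encard * (mOctant k - 1) + 1)) ∧
    (∀ p₁ p₂ p₃ : ℕ, 2 ≤ p₁ → 2 ≤ p₂ → 2 ≤ p₃ →
      Nat.Coprime p₁ p₂ → Nat.Coprime p₁ p₃ → Nat.Coprime p₂ p₃ → 2 ≤ k →
        mInfiniteAP {d | ∃ j₁ j₂ j₃ : ℕ, d = p₁ ^ j₁ * p₂ ^ j₂ * p₃ ^ j₃} {0} k = ⊤) := by
  refine ⟨fun t _ => mInfiniteAP_pow_le k hk t, fun p q hp hq hpq M hM => ?_,
    fun p₁ p₂ p₃ h₁ h₂ h₃ h₁₂ h₁₃ h₂₃ hk2 =>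
      mInfiniteAP_three_eq_top h₁ h₂ h₃ h₁₂ h₁₃ h₂₃ hk2⟩
  have hle := mInfiniteAP_pow_mul_pow_le hk hp hq hpq hM
  refine ⟨hle, ?_⟩
  rintro rfl hp2 hq2
  refine le_antisymm hle ?_
  have hone : 1 ≤ mOctant k := by
    rcases mParam_eq_top_or octantFamily k with h | ⟨m, hm, h, -⟩
    · rw [mOctant, h]; exact le_top
    · rw [mOctant, h]; exact_mod_cast hm
  rw [Set.encard_singleton, one_mul, tsub_add_cancel_of_le hone]
  exact mOctant_le_mInfiniteAP hk hp2 hq2 hpq
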